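/- A trajectory with $k\ge 0$ segments in $\mathbb{R}^d$ is given by an ordered list of waypoints $p_1,\dots,p_{k+1}\in\mathbb{R}^d$; as a point set it is the union of the segments $\overline{p_jp_{j+1}}$, $1\le j\le k$ (the point $p_1$ if $k=0$). It touches a closed Euclidean ball $B_r(c)$ if it has a point in the ball. For a finite set $\mathcal{T}$ of trajectories let $f(\mathcal{T})=r^*(\mathcal{T})$ be the minimum radius $r\ge 0$ of a ball that touches every $T\in\mathcal{T}$ (trajectory minimum touching ball, TMTB). An LP-type problem is a finite set $S$ of constraints with a function $f:2^S\to\mathbb{R}$ such that for all $B\subseteq Y\subseteq S$ and $x\in S$: $f(B)\le f(Y)$ (monotonicity), and $f(B\cup\{x\})>f(B)=f(Y)$ implies $f(Y\cup\{x\})>f(Y)$ (locality). A basis of $Y\subseteq S$ is an inclusion-minimal $B\subseteq Y$ with $f(B)=f(Y)$; the combinatorial dimension is the maximal size of a basis of a subset of $S$. Every finite set $S$ of trajectories, with $f=r^*$, is an LP-type problem in this sense. For $n>4$ let $\mathcal{T}_n=\{T_0,\dots,T_{n-1}\}$ be the set of planar trajectories $$T_0:\ (0,0)\to(n+2,-\tfrac1{10}),\qquad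 T_1:\ (0,4)\to(3,1)\to(n+2,1),$$ $$T_i:\ (0,1)\to(i,1)\to(i+1,4)\to(i+2,1)\to(n+2,1)\qquad(2\le i\le n-1).$$ Lemma. (a) For every $n>4$, $\mathcal{T}_n$ consists of $n$ distinct trajectories with at most $4$ segments each; $f(\mathcal{T}_n\setminus\{T\})<f(\mathcal{T}_n)$ for every $T\in\mathcal{T}_n$; and the only basis of $\mathcal{T}_n$ is $\mathcal{T}_n$ itself. (b) Consequently the combinatorial dimension of TMTB with $k=4$ in the plane, as an LP-type problem, is unbounded: the supremum of the combinatorial dimensions of the TMTB problems on finite sets of planar trajectories with at most $4$ segments each is $\infty$. -/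

import Mathlib

noncomputable section

/-- Points of `ℝ^d` with the Euclidean norm. -/
abbrev Pt (d : ℕ) : Type := EuclideanSpace ℝ (Fin d)

/-- A trajectory in `ℝ^d`: a number `k` of segments and its ordered waypoints `p_0, …, p_k`. -/
structure Trajectory (d : ℕ) where
  numSegs : ℕ
  waypoint : Fin (numSegs + 1) → Pt d

namespace Trajectory

/-- The point set of a trajectory: the union of the segments joining consecutive waypoints.
(The waypoints are listed separately only so that a trajectory with no segment is a point.) -/
def carrier {d : ℕ} (T : Trajectory d) : Set (Pt d) :=
  Set.range T.waypoint ∪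
    ⋃ j : Fin T.numSegs, segment ℝ (T.waypoint j.castSucc) (T.waypoint j.succ)

/-- The trajectory touches the closed ball `B_r(c)`. -/
def Touches {d : ℕ} (T : Trajectory d) (c : Pt d) (r : ℝ) : Prop :=
  (T.carrier ∩ Metric.closedBall c r).Nonempty

end Trajectory

/-- The radii `r ≥ 0` of the balls that touch every trajectory of `S`. -/
def touchingRadii {d : ℕ} (S : Set (Trajectory d)) : Set ℝ :=
  {r | 0 ≤ r ∧ ∃ c : Pt d, ∀ T ∈ S, T.Touches c r}

/-- The minimum touching-ball radius `r*(S)`. For finite `S` it is attained, see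
`tmtbRadius_isLeast`. -/
def tmtbRadius {d : ℕ} (S : Set (Trajectory d)) : ℝ :=
  sInf (touchingRadii S)

theorem touchingRadii_bddBelow {d : ℕ} (S : Set (Trajectory d)) : BddBelow (touchingRadii S) :=
  ⟨0, fun _ hr => hr.1⟩

theorem Trajectory.isCompact_carrier {d : ℕ} (T : Trajectory d) : IsCompact T.carrier := by
  refine (Set.finite_range _).isCompact.union (isCompact_iUnion fun j => ?_)
  rw [segment_eq_image_lineMap]
  exact isCompact_Icc.image (by fun_prop)

theorem Trajectory.touches_iff {d : ℕ} (T : Trajectory d) (c : Pt d) (r : ℝ) :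
    T.Touches c r ↔ Metric.infDist c T.carrier ≤ r := by
  have hne : T.carrier.Nonempty := ⟨T.waypoint 0, Or.inl ⟨0, rfl⟩⟩
  constructor
  · rintro ⟨x, hx, hxr⟩
    refine (Metric.infDist_le_dist_of_mem hx).trans ?_
    rw [dist_comm]
    exact hxr
  · intro h
    obtain ⟨x, hx, hd⟩ := T.isCompact_carrier.exists_infDist_eq_dist hne c
    refine ⟨x, hx, ?_⟩
    rw [Metric.mem_closedBall, dist_comm, ← hd]
    exact h

theorem touchingRadii_nonempty {d : ℕ} {S : Set (Trajectory d)} (hS : S.Finite) :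
    (touchingRadii S).Nonempty := by
  obtain ⟨M, hM⟩ := (hS.image fun T => Metric.infDist (0 : Pt d) T.carrier).bddAbove
  refine ⟨max M 0, le_max_right _ _, 0, fun T hT => ?_⟩
  rw [T.touches_iff]
  exact (hM ⟨T, hT, rfl⟩).trans (le_max_left _ _)

/-- The minimum in the definition of `r*(S)` exists for every finite set of trajectories. -/
theorem tmtbRadius_isLeast {d : ℕ} {S : Set (Trajectory d)} (hS : S.Finite) :
    IsLeast (touchingRadii S) (tmtbRadius S) := by
  suffices h : IsClosed (touchingRadii S) from
    h.isLeast_csInf (touchingRadii_nonempty hS) (touchingRadii_bddBelow S)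
  rcases S.eq_empty_or_nonempty with rfl | ⟨T₀, hT₀⟩
  · have : touchingRadii (∅ : Set (Trajectory d)) = Set.Ici 0 := by
      ext r; simp [touchingRadii]
    rw [this]; exact isClosed_Ici
  · refine isClosed_of_closure_subset fun r hr => ?_
    obtain ⟨R, hR⟩ := T₀.isCompact_carrier.isBounded.subset_closedBall (0 : Pt d)
    obtain ⟨u, hu, hlim⟩ := mem_closure_iff_seq_limit.1 hr
    choose hu0 c hc using hu
    obtain ⟨M, hM⟩ := hlim.bddAbove_range
    have hb : ∀ n, c n ∈ Metric.closedBall (0 : Pt d) (M + R) := fun n => by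
      obtain ⟨x, hx, hxr⟩ := hc n T₀ hT₀
      have h1 : dist x 0 ≤ R := hR hx
      have h2 : dist x (c n) ≤ u n := hxr
      have h3 : u n ≤ M := hM ⟨n, rfl⟩
      have h4 := dist_triangle_left (c n) 0 x
      rw [Metric.mem_closedBall]
      linarith
    obtain ⟨c', -, φ, hφ, hc'⟩ := (isCompact_closedBall (0 : Pt d) (M + R)).tendsto_subseq hb
    have hlim' := hlim.comp hφ.tendsto_atTop
    refine ⟨ge_of_tendsto' hlim hu0, c', fun T hT => ?_⟩
    rw [T.touches_iff]
    refine le_of_tendsto_of_tendsto'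
      (((Metric.continuous_infDist_pt T.carrier).tendsto c').comp hc') hlim' fun n => ?_
    exact (T.touches_iff _ _).1 (hc (φ n) T hT)

theorem tmtbRadius_mono {d : ℕ} {B Y : Set (Trajectory d)} (hY : Y.Finite) (h : B ⊆ Y) :
    tmtbRadius B ≤ tmtbRadius Y :=
  csInf_le_csInf (touchingRadii_bddBelow B) (touchingRadii_nonempty hY)
    fun _ hr => ⟨hr.1, hr.2.imp fun _ hc T hT => hc T (h hT)⟩

/-- An LP-type problem: a finite set of constraints and an objective on its subsets that
satisfies monotonicity and locality. -/
structure LPTypeProblem (α : Type*) where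
  constraints : Set α
  finite : constraints.Finite
  objective : Set α → ℝ
  monotonicity : ∀ B Y : Set α, B ⊆ Y → Y ⊆ constraints → objective B ≤ objective Y
  locality : ∀ (B Y : Set α) (x : α), B ⊆ Y → Y ⊆ constraints → x ∈ constraints →
    objective B < objective (insert x B) → objective B = objective Y →
      objective Y < objective (insert x Y)

namespace LPTypeProblem

/-- `B` is a basis of `Y`: a minimal subset of `Y` with `f(B) = f(Y)`. -/
def IsBasis {α : Type*} (P : LPTypeProblem α) (B Y : Set α) : Prop :=
  B ⊆ Y ∧ P.objective B = P.objective Y ∧ ∀ B' : Set α, B' ⊂ B → P.objective B' ≠ P.objective Y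

/-- The combinatorial dimension: the maximal size of a basis of a set of constraints. -/
def combDim {α : Type*} (P : LPTypeProblem α) : ℕ∞ :=
  ⨆ (B : Set α) (Y : Set α) (_ : Y ⊆ P.constraints) (_ : P.IsBasis B Y), B.encard

end LPTypeProblem

/-- The trajectory minimum touching ball problem on a finite set of trajectories, as an LP-type
problem. -/
def tmtb {d : ℕ} (S : Set (Trajectory d)) (hS : S.Finite) : LPTypeProblem (Trajectory d) where
  constraints := S
  finite := hS
  objective := tmtbRadius
  monotonicity := fun _ _ hBY hY => tmtbRadius_mono (hS.subset hY) hBY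
  locality := fun _ _ _ hBY hY hx hlt heq =>
    heq ▸ hlt.trans_le (tmtbRadius_mono
      (hS.subset (Set.insert_subset hx hY)) (Set.insert_subset_insert hBY))

/-- The combinatorial dimension of the problem for trajectories in `ℝ^d` with at most `k`
segments: the supremum over all finite instances. -/
def tmtbCombDim (d k : ℕ) : ℕ∞ :=
  ⨆ (S : Set (Trajectory d)) (hS : S.Finite) (_ : ∀ T ∈ S, T.numSegs ≤ k), (tmtb S hS).combDim

/-- The slanted base segment. -/
def baseTraj (n : ℕ) : Trajectory 2 :=
  ⟨1, ![!₂[0, 0], !₂[(n : ℝ) + 2, -(1 / 10)]]⟩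

/-- The descending trajectory. -/
def descTraj (n : ℕ) : Trajectory 2 :=
  ⟨2, ![!₂[0, 4], !₂[3, 1], !₂[(n : ℝ) + 2, 1]]⟩

/-- The arch over the interval `[i, i + 2]`. -/
def archTraj (n i : ℕ) : Trajectory 2 :=
  ⟨4, ![!₂[0, 1], !₂[(i : ℝ), 1], !₂[(i : ℝ) + 1, 4], !₂[(i : ℝ) + 2, 1], !₂[(n : ℝ) + 2, 1]]⟩

/-- The trajectories `T_0` (base), `T_1` (descending) and `T_i`, `i ≥ 2` (arches). -/
def monsterTraj (n : ℕ) : ℕ → Trajectory 2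
  | 0 => baseTraj n
  | 1 => descTraj n
  | i + 2 => archTraj n (i + 2)

/-- The configuration `{T_0, …, T_{n-1}}`. -/
def monster (n : ℕ) : Set (Trajectory 2) :=
  monsterTraj n '' Set.Iio n

theorem monster_finite (n : ℕ) : (monster n).Finite :=
  (Set.finite_Iio n).image _

end

/-! All trajectories but the base stay at height at least 1, so a small ball touching the base
reaches them only through a narrow cap. `T_1` pushes the cap right, and each arch `T_i`, being
steep, pushes it past `i + 2`. Since the base slopes down, room costs more to the right: the last
arch forces a radius above `halfWidth n n` (`halfWidth_lt_of_touches`). Deleting any one trajectory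
opens an escape of radius at most `halfWidth n n` (`tmtbRadius_monster_diff_le`). Hence every
deletion lowers the optimum, by monotonicity no proper subset attains it, and the dimension is at
least `n` for every `n > 4`. -/

theorem mem_closedBall_plane {p c : Pt 2} {r : ℝ} (hr : 0 ≤ r) :
    p ∈ Metric.closedBall c r ↔ (p 0 - c 0) ^ 2 + (p 1 - c 1) ^ 2 ≤ r ^ 2 := by
  rw [Metric.mem_closedBall, EuclideanSpace.dist_eq, Fin.sum_univ_two, Real.dist_eq, Real.dist_eq,
    sq_abs, sq_abs, Real.sqrt_le_left hr]

/-! ### Points on the trajectories and linear constraints they satisfy -/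

namespace Trajectory

theorem segment_subset_carrier {d : ℕ} (T : Trajectory d) (j : Fin T.numSegs) :
    segment ℝ (T.waypoint j.castSucc) (T.waypoint j.succ) ⊆ T.carrier :=
  fun _ hx => Or.inr (Set.mem_iUnion.2 ⟨j, hx⟩)

/-- A set containing every waypoint and every segment contains the trajectory. -/
theorem carrier_induction {d : ℕ} {T : Trajectory d} {P : Pt d → Prop}
    (hw : ∀ j, P (T.waypoint j))
    (hs : ∀ (j : Fin T.numSegs) (a b : ℝ), 0 ≤ a → 0 ≤ b → a + b = 1 →
      P (a • T.waypoint j.castSucc + b • T.waypoint j.succ))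
    {p : Pt d} (hp : p ∈ T.carrier) : P p := by
  rcases hp with ⟨j, rfl⟩ | hp
  · exact hw j
  · obtain ⟨j, a, b, ha, hb, hab, rfl⟩ := Set.mem_iUnion.1 hp
    exact hs j a b ha hb hab

end Trajectory

theorem mem_segment_horizontal {u v x y : ℝ} (h₁ : u ≤ x) (h₂ : x ≤ v) :
    (!₂[x, y] : Pt 2) ∈ segment ℝ !₂[u, y] !₂[v, y] := by
  rcases h₁.eq_or_lt with rfl | h₁
  · exact left_mem_segment _ _ _
  have huv : 0 < v - u := by linarith
  refine ⟨(v - x) / (v - u), (x - u) / (v - u), div_nonneg (by linarith) huv.le,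
    div_nonneg (by linarith) huv.le, by field_simp; ring, ?_⟩
  ext i
  fin_cases i
  · simp; field_simp; ring
  · simp; field_simp; ring

/-- The downward slope of the base segment. -/
noncomputable def baseSlope (n : ℕ) : ℝ := 1 / (10 * ((n : ℝ) + 2))

theorem baseSlope_pos (n : ℕ) : 0 < baseSlope n := by unfold baseSlope; positivity

theorem baseSlope_mul (n : ℕ) : baseSlope n * ((n : ℝ) + 2) = 1 / 10 := by
  unfold baseSlope; field_simp

theorem baseSlope_le (n : ℕ) : baseSlope n ≤ 1 / 20 := by
  have := baseSlope_mul n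
  nlinarith [baseSlope_pos n, Nat.cast_nonneg (α := ℝ) n]

theorem mem_baseTraj {n : ℕ} {x : ℝ} (h₀ : 0 ≤ x) (h₁ : x ≤ n + 2) :
    (!₂[x, -(baseSlope n * x)] : Pt 2) ∈ (baseTraj n).carrier := by
  have hn : (0 : ℝ) < n + 2 := by positivity
  refine (baseTraj n).segment_subset_carrier (0 : Fin 1) ?_
  refine ⟨1 - x / (n + 2), x / (n + 2), sub_nonneg.2 ((div_le_one hn).2 h₁),
    div_nonneg h₀ hn.le, by ring, ?_⟩
  ext i
  fin_cases i
  · simp [baseTraj]; field_simp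
  · simp [baseTraj, baseSlope]; field_simp

theorem baseTraj_carrier {n : ℕ} {p : Pt 2} (hp : p ∈ (baseTraj n).carrier) :
    p 1 + baseSlope n * p 0 = 0 ∧ p 1 ≤ 0 := by
  have hs := baseSlope_mul n
  refine Trajectory.carrier_induction
    (P := fun p : Pt 2 => p 1 + baseSlope n * p 0 = 0 ∧ p 1 ≤ 0) ?_ ?_ hp
  · intro (j : Fin 2)
    fin_cases j <;> simp [baseTraj]
    linarith
  · intro (j : Fin 1) a b ha hb hab
    fin_cases j
    simp [baseTraj]
    constructor <;> nlinarith

theorem mem_descTraj {n : ℕ} {x : ℝ} (h₀ : 3 ≤ x) (h₁ : x ≤ n + 2) :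
    (!₂[x, 1] : Pt 2) ∈ (descTraj n).carrier :=
  (descTraj n).segment_subset_carrier (1 : Fin 2) (mem_segment_horizontal h₀ h₁)

theorem descTraj_carrier {n : ℕ} (hn : 1 ≤ n) {p : Pt 2} (hp : p ∈ (descTraj n).carrier) :
    1 ≤ p 1 ∧ 4 ≤ p 0 + p 1 := by
  have hn' : (1 : ℝ) ≤ n := by exact_mod_cast hn
  refine Trajectory.carrier_induction (P := fun p : Pt 2 => 1 ≤ p 1 ∧ 4 ≤ p 0 + p 1) ?_ ?_ hp
  · intro (j : Fin 3)
    fin_cases j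
    · simp [descTraj]
    · simp [descTraj]
      norm_num
    · simp [descTraj]
      linarith
  · intro (j : Fin 2) a b ha hb hab
    obtain rfl : a = 1 - b := by linarith
    fin_cases j
    · simp [descTraj]
      constructor <;> nlinarith
    · simp [descTraj]
      nlinarith

theorem mem_archTraj_left {n i : ℕ} {x : ℝ} (h₀ : 0 ≤ x) (h₁ : x ≤ i) :
    (!₂[x, 1] : Pt 2) ∈ (archTraj n i).carrier :=
  (archTraj n i).segment_subset_carrier (0 : Fin 4) (mem_segment_horizontal h₀ h₁)

theorem mem_archTraj_right {n i : ℕ} {x : ℝ} (h₀ : (i : ℝ) + 2 ≤ x) (h₁ : x ≤ n + 2) :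
    (!₂[x, 1] : Pt 2) ∈ (archTraj n i).carrier :=
  (archTraj n i).segment_subset_carrier (3 : Fin 4) (mem_segment_horizontal h₀ h₁)

/-- Each half-plane is bounded by the line through one leg of the arch (slope 3 or -3) and contains
that leg and the horizontal run on its side. Low points are thus left of about `i` or right of about
`i + 2`. -/
theorem archTraj_carrier {n i : ℕ} (hi : i ≤ n) {p : Pt 2} (hp : p ∈ (archTraj n i).carrier) :
    1 ≤ p 1 ∧ (3 * (p 0 - i) ≤ p 1 - 1 ∨ 3 * (i + 2 - p 0) ≤ p 1 - 1) := by
  have hi' : (i : ℝ) ≤ n := by exact_mod_cast hi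
  have hi0 : (0 : ℝ) ≤ i := by positivity
  refine Trajectory.carrier_induction (P := fun p : Pt 2 =>
    1 ≤ p 1 ∧ (3 * (p 0 - i) ≤ p 1 - 1 ∨ 3 * (i + 2 - p 0) ≤ p 1 - 1)) ?_ ?_ hp
  · intro (j : Fin 5)
    fin_cases j
    · exact ⟨by simp [archTraj], Or.inl (by simp [archTraj])⟩
    · exact ⟨by simp [archTraj], Or.inl (by simp [archTraj])⟩
    · exact ⟨by simp [archTraj], Or.inl (by simp [archTraj]; norm_num)⟩
    · exact ⟨by simp [archTraj], Or.inr (by simp [archTraj])⟩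
    · exact ⟨by simp [archTraj], Or.inr (by simp [archTraj]; linarith)⟩
  · intro (j : Fin 4) a b ha hb hab
    obtain rfl : a = 1 - b := by linarith
    fin_cases j
    · exact ⟨by simp [archTraj], Or.inl (by simp [archTraj]; nlinarith)⟩
    · exact ⟨by simp [archTraj]; nlinarith, Or.inl (by simp [archTraj]; nlinarith)⟩
    · exact ⟨by simp [archTraj]; nlinarith, Or.inr (by simp [archTraj]; nlinarith)⟩
    · exact ⟨by simp [archTraj], Or.inr (by simp [archTraj]; nlinarith)⟩

/-! ### Balls between the base and height 1 -/

theorem tmtbRadius_le {d : ℕ} {S : Set (Trajectory d)} {c : Pt d} {r : ℝ} (hr : 0 ≤ r)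
    (h : ∀ T ∈ S, T.Touches c r) : tmtbRadius S ≤ r :=
  csInf_le (touchingRadii_bddBelow S) ⟨hr, c, h⟩

/-- Half the distance from `(x, 1)` to the line through the base segment. -/
noncomputable def halfWidth (n : ℕ) (x : ℝ) : ℝ := (1 + baseSlope n * x) / (2 * √(1 + baseSlope n ^ 2))

theorem halfWidth_mul (n : ℕ) (x : ℝ) :
    2 * halfWidth n x * √(1 + baseSlope n ^ 2) = 1 + baseSlope n * x := by
  have : 0 < √(1 + baseSlope n ^ 2) := Real.sqrt_pos.2 (by positivity)
  unfold halfWidth; field_simp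

theorem halfWidth_sq (n : ℕ) (x : ℝ) :
    halfWidth n x ^ 2 = (1 + baseSlope n * x) ^ 2 / (4 * (1 + baseSlope n ^ 2)) := by
  unfold halfWidth
  rw [div_pow, mul_pow, Real.sq_sqrt (by positivity)]
  norm_num

theorem halfWidth_mono (n : ℕ) : Monotone (halfWidth n) := fun x y h => by
  unfold halfWidth
  have := baseSlope_pos n
  gcongr

theorem halfWidth_nonneg (n : ℕ) {x : ℝ} (hx : 0 ≤ x) : 0 ≤ halfWidth n x := by
  have := baseSlope_pos n
  unfold halfWidth
  positivity

theorem half_le_halfWidth (n : ℕ) {x : ℝ} (hx : 1 ≤ x) : 1 / 2 ≤ halfWidth n x := by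
  have h0 := baseSlope_pos n
  have hx' : baseSlope n ≤ baseSlope n * x := le_mul_of_one_le_right h0.le hx
  have h : √(1 + baseSlope n ^ 2) ≤ 1 + baseSlope n * x :=
    (Real.sqrt_le_left (by positivity)).2 (by nlinarith)
  have hN : 1 ≤ √(1 + baseSlope n ^ 2) := Real.one_le_sqrt.2 (by nlinarith)
  have := halfWidth_mul n x
  nlinarith

theorem halfWidth_le (n : ℕ) {x : ℝ} (h₀ : 0 ≤ x) (hx : x ≤ n + 2) : halfWidth n x ≤ 11 / 20 := by
  have h0 := baseSlope_pos n
  have hN : 1 ≤ √(1 + baseSlope n ^ 2) := Real.one_le_sqrt.2 (by nlinarith)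
  have := halfWidth_mul n x
  have := halfWidth_nonneg n h₀
  have := mul_le_mul_of_nonneg_left hx h0.le
  have := baseSlope_mul n
  nlinarith

/-- A ball of radius `halfWidth n x` touching both the base segment and the point `(x, 1)`. -/
theorem exists_ball_baseTraj (n : ℕ) {x : ℝ} (h₀ : 1 ≤ x) (h₁ : x ≤ n + 2) :
    ∃ c : Pt 2, (baseTraj n).Touches c (halfWidth n x) ∧
      !₂[x, 1] ∈ Metric.closedBall c (halfWidth n x) := by
  have hr := halfWidth_nonneg n (zero_le_one.trans h₀)
  have hs := baseSlope_pos n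
  have hs' := baseSlope_le n
  have hpos : 0 < 1 + baseSlope n ^ 2 := by positivity
  set s := baseSlope n with hsdef
  -- The touching point is the foot of the perpendicular from `(x, 1)` to the base line, and the
  -- center is the midpoint. As `s ≤ 1/20` and `x ≥ 1`, the foot does not fall left of the base.
  refine ⟨!₂[x - s * (1 + s * x) / (2 * (1 + s ^ 2)), 1 - (1 + s * x) / (2 * (1 + s ^ 2))],
    ⟨!₂[(x - s) / (1 + s ^ 2), -(s * ((x - s) / (1 + s ^ 2)))], ?_, ?_⟩, ?_⟩
  · refine mem_baseTraj (div_nonneg (by linarith) hpos.le) ?_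
    rw [div_le_iff₀ hpos]
    nlinarith
  · rw [mem_closedBall_plane hr, halfWidth_sq]
    refine le_of_eq ?_
    simp only [← hsdef]
    simp
    field_simp
    ring
  · rw [mem_closedBall_plane hr, halfWidth_sq]
    refine le_of_eq ?_
    simp only [← hsdef]
    simp
    field_simp
    ring

/-! ### Distinctness and size of the family -/

theorem monsterTraj_arch {n i : ℕ} (hi : 2 ≤ i) : monsterTraj n i = archTraj n i := by
  obtain ⟨k, rfl⟩ := Nat.exists_eq_add_of_le' hi
  rfl

theorem monsterTraj_injective (n : ℕ) : Function.Injective (monsterTraj n) := by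
  have harch : ∀ i j : ℕ, archTraj n i = archTraj n j → i = j := fun i j h => by
    simp only [archTraj, Trajectory.mk.injEq, heq_eq_eq, true_and] at h
    have h1 := congrArg (fun p : Pt 2 => p 0) (congrFun h (1 : Fin 5))
    simpa using h1
  have hseg : ∀ i j, monsterTraj n i = monsterTraj n j →
      (monsterTraj n i).numSegs = (monsterTraj n j).numSegs := fun i j h => by rw [h]
  rintro (_ | _ | i) (_ | _ | j) h
  · rfl
  · exact absurd (hseg _ _ h) (by simp [monsterTraj, baseTraj, descTraj])
  · exact absurd (hseg _ _ h) (by simp [monsterTraj, baseTraj, archTraj])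
  · exact absurd (hseg _ _ h) (by simp [monsterTraj, baseTraj, descTraj])
  · rfl
  · exact absurd (hseg _ _ h) (by simp [monsterTraj, descTraj, archTraj])
  · exact absurd (hseg _ _ h) (by simp [monsterTraj, baseTraj, archTraj])
  · exact absurd (hseg _ _ h) (by simp [monsterTraj, descTraj, archTraj])
  · exact harch _ _ h

theorem numSegs_monsterTraj_le (n i : ℕ) : (monsterTraj n i).numSegs ≤ 4 := by
  rcases i with _ | _ | i <;> simp [monsterTraj, baseTraj, descTraj, archTraj]

theorem encard_monster (n : ℕ) : (monster n).encard = n := by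
  rw [monster, (monsterTraj_injective n).encard_image, Set.encard_eq_coe_toFinset_card]
  simp

/-! ### Upper bound after a deletion -/

/-- Removing any trajectory allows a ball of radius at most `halfWidth n n`. -/
theorem tmtbRadius_monster_diff_le {n k : ℕ} (hn : 4 < n) (hk : k < n) :
    tmtbRadius (monster n \ {monsterTraj n k}) ≤ halfWidth n n := by
  have hn' : (5 : ℝ) ≤ n := by exact_mod_cast hn
  have hr := half_le_halfWidth n (x := n) (by linarith)
  suffices h : ∃ (c : Pt 2) (r : ℝ), 0 ≤ r ∧ r ≤ halfWidth n n ∧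
      ∀ j < n, j ≠ k → (monsterTraj n j).Touches c r by
    obtain ⟨c, r, hr0, hrn, h⟩ := h
    refine (tmtbRadius_le (c := c) hr0 ?_).trans hrn
    rintro _ ⟨⟨j, hj, rfl⟩, hjk⟩
    exact h j hj fun h => hjk (h ▸ rfl)
  rcases k with _ | _ | k
  -- Without the base, all share their right endpoint.
  · refine ⟨!₂[n + 2, 1], 0, le_rfl, by linarith, fun j hj hjk => ⟨!₂[n + 2, 1], ?_, by simp⟩⟩
    rcases j with _ | _ | j
    · exact absurd rfl hjk
    · exact mem_descTraj (by linarith) le_rfl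
    · have : ((j + 2 : ℕ) : ℝ) ≤ n := by exact_mod_cast hj.le
      exact mem_archTraj_right (by linarith) le_rfl
  -- Without `T_1`, the ball fits at the left end, between the base and the arches' common start.
  · refine ⟨!₂[0, 1 / 2], 1 / 2, by norm_num, hr, fun j hj hjk => ?_⟩
    rcases j with _ | _ | j
    · refine ⟨!₂[0, -(baseSlope n * 0)], mem_baseTraj le_rfl (by linarith), ?_⟩
      rw [mem_closedBall_plane (by norm_num)]
      norm_num
    · exact absurd rfl hjk
    · refine ⟨!₂[0, 1], mem_archTraj_left le_rfl (by positivity), ?_⟩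
      rw [mem_closedBall_plane (by norm_num)]
      norm_num
  · have hk' : (k : ℝ) + 3 ≤ n := by exact_mod_cast hk
    have hk0 : (0 : ℝ) ≤ k := by positivity
    -- The abscissa `k + 3` is that of the deleted arch's apex: at it, earlier arches have come down
    -- and later ones have not yet risen.
    obtain ⟨c, hc0, hc⟩ := exists_ball_baseTraj n (x := k + 3) (by linarith) (by linarith)
    refine ⟨c, halfWidth n (k + 3), halfWidth_nonneg n (by positivity), halfWidth_mono n hk',
      fun j hj hjk => ?_⟩
    rcases j with _ | _ | j
    · exact hc0
    · exact ⟨_, mem_descTraj (by linarith) (by linarith), hc⟩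
    · refine ⟨_, ?_, hc⟩
      rcases lt_or_gt_of_ne hjk with h | h
      · have : (j : ℝ) + 1 ≤ k := by exact_mod_cast (show j + 1 ≤ k by omega)
        exact mem_archTraj_right (by push_cast; linarith) (by linarith)
      · have : (k : ℝ) + 1 ≤ j := by exact_mod_cast (show k + 1 ≤ j by omega)
        exact mem_archTraj_left (by positivity) (by push_cast; linarith)

/-! ### Lower bound for the whole family -/

/-- No ball of radius at most `halfWidth n n` touches the whole configuration. -/
theorem halfWidth_lt_of_touches {n : ℕ} (hn : 4 < n) {c : Pt 2} {r : ℝ} (hr : 0 ≤ r)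
    (h : ∀ j < n, (monsterTraj n j).Touches c r) : halfWidth n n < r := by
  by_contra! hle
  have hs := baseSlope_pos n
  have hs' := baseSlope_le n
  have hr' : r ≤ 11 / 20 := hle.trans (halfWidth_le n (by positivity) (by linarith))
  obtain ⟨p, hp, hpc⟩ := h 0 (by omega)
  obtain ⟨hpL, hp1⟩ := baseTraj_carrier hp
  rw [mem_closedBall_plane hr] at hpc
  have hc1 : c 1 ≤ 11 / 20 := by
    have := abs_le_of_sq_le_sq' (show (p 1 - c 1) ^ 2 ≤ r ^ 2 by nlinarith [sq_nonneg (p 0 - c 0)]) hr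
    linarith
  -- The cap's squared half-width is at most `(11/20)² - (9/20)² = 1/10 < (8/25)²`.
  have cap : ∀ q ∈ Metric.closedBall c r, 1 ≤ q 1 →
      q 1 ≤ 11 / 10 ∧ q 0 ≤ c 0 + 8 / 25 ∧ c 0 ≤ q 0 + 8 / 25 := by
    intro q hq hq1
    rw [mem_closedBall_plane hr] at hq
    have h1 := abs_le_of_sq_le_sq' (show (q 1 - c 1) ^ 2 ≤ r ^ 2 by nlinarith [sq_nonneg (q 0 - c 0)]) hr
    have h2 : (q 0 - c 0) ^ 2 ≤ (8 / 25 : ℝ) ^ 2 := by nlinarith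
    have h3 := abs_le_of_sq_le_sq' h2 (by norm_num)
    exact ⟨by linarith, by linarith, by linarith⟩
  -- The left alternative would give `c 0 ≤ j + 2 + 1/30 + 8/25`, which is below `j + 2 + 1/2`.
  have arch : ∀ j, j + 2 < n → (j : ℝ) + 2 + 1 / 2 ≤ c 0 → ∃ q ∈ Metric.closedBall c r,
      1 ≤ q 1 ∧ 3 * ((j : ℝ) + 4 - q 0) ≤ q 1 - 1 := by
    intro j hj hjc
    obtain ⟨q, hq, hqc⟩ := h (j + 2) hj
    obtain ⟨hq1, hq2⟩ := archTraj_carrier hj.le hq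
    push_cast at hq2
    obtain ⟨h1, h2, h3⟩ := cap q hqc hq1
    refine ⟨q, hqc, hq1, ?_⟩
    rcases hq2 with hq2 | hq2 <;> linarith
  have march : ∀ j, j + 2 < n → (j : ℝ) + 2 + 1 / 2 ≤ c 0 := by
    intro j
    induction j with
    | zero =>
      intro _
      obtain ⟨q, hq, hqc⟩ := h 1 (by omega)
      obtain ⟨hq1, hq2⟩ := descTraj_carrier (by omega) hq
      obtain ⟨h1, h2, h3⟩ := cap q hqc hq1
      push_cast
      linarith
    | succ j ih =>
      intro hj
      obtain ⟨q, hqc, hq1, hq2⟩ := arch j (by omega) (ih (by omega))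
      obtain ⟨h1, h2, h3⟩ := cap q hqc hq1
      push_cast
      linarith
  -- The last arch has index `m + 2 = n - 1` and ends at abscissa `n + 1`, beyond the `n` of
  -- `halfWidth n n`.
  obtain ⟨m, rfl⟩ := Nat.exists_eq_add_of_le' (show 3 ≤ n by omega)
  obtain ⟨q, hqc, hq1, hq2⟩ := arch m (by omega) (march m (by omega))
  rw [mem_closedBall_plane hr] at hqc
  set s := baseSlope (m + 3)
  set N := √(1 + s ^ 2) with hN
  have hNsq : N ^ 2 = 1 + s ^ 2 := Real.sq_sqrt (by positivity)
  -- Cauchy–Schwarz against the base line's normal `(s, 1)`. Used on `q - c` and `c - p`, it bounds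
  -- the distance from `q` to the base line by `2 * r`.
  have functional : ∀ a b : ℝ, a ^ 2 + b ^ 2 ≤ r ^ 2 → b + s * a ≤ N * r := by
    intro a b hab
    refine abs_le_of_sq_le_sq (a := b + s * a) ?_ (by positivity) |>.trans' (le_abs_self _)
    rw [mul_pow, hNsq]
    nlinarith [sq_nonneg (a - s * b)]
  have f1 := functional (q 0 - c 0) (q 1 - c 1) hqc
  have f2 := functional (c 0 - p 0) (c 1 - p 1) (by linarith)
  have hw := halfWidth_mul (m + 3) (m + 3 : ℕ)
  have hN0 : 0 ≤ N := Real.sqrt_nonneg _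
  have hle' := mul_le_mul_of_nonneg_left hle hN0
  push_cast at hw hle'
  have hq0 : s * (3 * ((m : ℝ) + 4 - q 0)) ≤ s * (q 1 - 1) := mul_le_mul_of_nonneg_left hq2 hs.le
  have hq3 : s * (q 1 - 1) ≤ 1 * (q 1 - 1) :=
    mul_le_mul_of_nonneg_right (by linarith) (by linarith)
  nlinarith

theorem halfWidth_lt_tmtbRadius_monster {n : ℕ} (hn : 4 < n) :
    halfWidth n n < tmtbRadius (monster n) := by
  obtain ⟨hr, c, hc⟩ := (tmtbRadius_isLeast (monster_finite n)).1
  exact halfWidth_lt_of_touches hn hr fun j hj => hc _ ⟨j, hj, rfl⟩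

theorem tmtbRadius_monster_diff_lt {n : ℕ} (hn : 4 < n) {T : Trajectory 2} (hT : T ∈ monster n) :
    tmtbRadius (monster n \ {T}) < tmtbRadius (monster n) := by
  obtain ⟨k, hk, rfl⟩ := hT
  exact (tmtbRadius_monster_diff_le hn hk).trans_lt (halfWidth_lt_tmtbRadius_monster hn)

/-! ### Bases and combinatorial dimension -/

theorem LPTypeProblem.isBasis_iff_eq_of_forall_diff_lt {α : Type*} (P : LPTypeProblem α)
    {Y : Set α} (hY : Y ⊆ P.constraints)
    (h : ∀ x ∈ Y, P.objective (Y \ {x}) < P.objective Y) (B : Set α) :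
    P.IsBasis B Y ↔ B = Y := by
  have key : ∀ B', B' ⊂ Y → P.objective B' ≠ P.objective Y := fun B' hB' => by
    obtain ⟨x, hx, hxB⟩ := Set.exists_of_ssubset hB'
    have hsub : B' ⊆ Y \ {x} := fun y hy => ⟨hB'.1 hy, fun hyx => hxB (hyx ▸ hy)⟩
    exact ((P.monotonicity _ _ hsub (Set.sdiff_subset.trans hY)).trans_lt (h x hx)).ne
  constructor
  · rintro ⟨hB, heq, -⟩
    by_contra hne
    exact key B (hB.ssubset_of_ne hne) heq
  · rintro rfl
    exact ⟨subset_rfl, rfl, key⟩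

theorem isBasis_monster_iff {n : ℕ} (hn : 4 < n) (B : Set (Trajectory 2)) :
    (tmtb (monster n) (monster_finite n)).IsBasis B (monster n) ↔ B = monster n :=
  LPTypeProblem.isBasis_iff_eq_of_forall_diff_lt _ subset_rfl
    (fun _ hT => tmtbRadius_monster_diff_lt hn hT) B

theorem numSegs_le_of_mem_monster {n : ℕ} {T : Trajectory 2} (hT : T ∈ monster n) :
    T.numSegs ≤ 4 := by
  obtain ⟨k, -, rfl⟩ := hT
  exact numSegs_monsterTraj_le n k

theorem le_tmtbCombDim {n : ℕ} (hn : 4 < n) : (n : ℕ∞) ≤ tmtbCombDim 2 4 := by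
  rw [← encard_monster n]
  have hdim : (monster n).encard ≤ (tmtb (monster n) (monster_finite n)).combDim :=
    le_iSup₂_of_le (monster n) (monster n)
      (le_iSup₂_of_le subset_rfl ((isBasis_monster_iff hn _).2 rfl) le_rfl)
  exact hdim.trans (le_iSup₂_of_le (monster n) (monster_finite n)
    (le_iSup_of_le (fun _ hT => numSegs_le_of_mem_monster hT) le_rfl))

theorem lemma2 :
    (∀ n : ℕ, 4 < n →
      (monster n).encard = n ∧
      (∀ T ∈ monster n, T.numSegs ≤ 4) ∧
      (∀ T ∈ monster n, tmtbRadius (monster n \ {T}) < tmtbRadius (monster n)) ∧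
      (∀ B : Set (Trajectory 2),
        (tmtb (monster n) (monster_finite n)).IsBasis B (monster n) ↔ B = monster n)) ∧
    tmtbCombDim 2 4 = ⊤ := by
  refine ⟨fun n hn => ⟨encard_monster n, fun _ => numSegs_le_of_mem_monster,
    fun _ => tmtbRadius_monster_diff_lt hn, isBasis_monster_iff hn⟩, ?_⟩
  refine ENat.eq_top_iff_forall_ge.2 fun m => ?_
  exact (Nat.cast_le.2 (show m ≤ m + 5 by omega)).trans (le_tmtbCombDim (n := m + 5) (by omega))
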